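/- Let $k$ be a field. All algebras are associative $k$-algebras, not necessarily unital, and subalgebras need not contain an identity element. An \emph{unrefinable chain} of length $t\ge 0$ of an algebra $A$ is a chain of $k$-subalgebras $A=A_0>A_1>\dots>A_t=0$ in which each $A_i$ is a maximal (proper) subalgebra of $A_{i-1}$. The \emph{length} $l(A)\in\mathbb{N}\cup\{\infty\}$ of $A$ is the maximal length of an unrefinable chain of $A$, with $l(A)=\infty$ if there is no unrefinable chain, or none of maximal length. Let $J(A)$ denote the Jacobson radical of $A$. \textbf{Theorem.} Let $A$ be a finite-dimensional $k$-algebra, and suppose that $A/J(A)\cong\prod_{i=1}^m M_{n_i}(D_i)$ as $k$-algebras, where $m\ge 0$ and $n_1,\dots,n_m\ge 1$ are integers and $D_1,\dots,D_m$ are division algebras over $k$. Then $$l(A)=\dim_k J(A)+\sum_{i=1}^m\Big(n_i-1+\frac{n_i(n_i-1)}{2}\,[D_i:k]+n_i\,l(D_i)\Big),$$ where $[D_i:k]=\dim_k D_i$ and $l(D_i)$ is the length of $D_i$ as a $k$-algebra. -/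

import Mathlib

namespace AssocAlg

section Length

variable (k : Type*) (A : Type*) [Field k] [NonUnitalRing A] [Module k A]
  [IsScalarTower k A A] [SMulCommClass k A A]

/-- `c` is an unrefinable chain `A = c 0 > c 1 > ... > c t = 0` of length `t` of the (not necessarily
unital) `k`-algebra `A`: each `c (i + 1)` is a maximal `k`-subalgebra of `c i`. Subalgebras are
not required to contain an identity element. -/
def IsUnrefinableChain (t : ℕ) (c : Fin (t + 1) → NonUnitalSubalgebra k A) : Prop :=
  c 0 = ⊤ ∧ c (Fin.last t) = ⊥ ∧ ∀ i : Fin t, c i.succ ⋖ c i.castSucc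

/-- The set of all lengths of unrefinable chains of `A`. -/
def chainLengths : Set ℕ :=
  {t | ∃ c : Fin (t + 1) → NonUnitalSubalgebra k A, IsUnrefinableChain k A t c}

open Classical in
/-- The length `l(A)`: the maximal length of an unrefinable chain of `A`, and `∞` if there is no
unrefinable chain or no unrefinable chain of maximal length. -/
noncomputable def length : ℕ∞ :=
  if h : ∃ t : ℕ, IsGreatest (chainLengths k A) t then ((h.choose : ℕ) : ℕ∞) else ⊤

end Length

section UnitalFacts

variable {R : Type*} [Ring R]

theorem isUnit_one_add_of_mem_jacobson {x : R} (hx : x ∈ Ring.jacobson R) : IsUnit (1 + x) := by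
  have key : ∀ y ∈ Ring.jacobson R, ∃ z : R, z * (1 + y) = 1 := by
    intro y hy
    rw [← Ideal.jacobson_bot, Ideal.mem_jacobson_iff] at hy
    obtain ⟨z, hz⟩ := hy 1
    refine ⟨z, ?_⟩
    have h0 : z * 1 * y + z - 1 = 0 := by simpa using hz
    rw [mul_one] at h0
    rw [mul_add, mul_one, add_comm]
    exact sub_eq_zero.mp h0
  obtain ⟨z, hz⟩ := key x hx
  obtain ⟨w, hw⟩ := key (-(z * x)) (neg_mem (Ideal.mul_mem_left _ z hx))
  have hzx : 1 + -(z * x) = z := by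
    rw [← hz, mul_add, mul_one]
    abel
  rw [hzx] at hw
  have hwx : w = 1 + x := by
    calc w = w * (z * (1 + x)) := by rw [hz, mul_one]
      _ = 1 + x := by rw [← mul_assoc, hw, one_mul]
  exact ⟨⟨1 + x, z, by rw [← hwx]; exact hw, hz⟩, rfl⟩

theorem mem_jacobson_of_isUnit {x : R} (hx : ∀ y : R, IsUnit (1 + y * x)) :
    x ∈ Ring.jacobson R := by
  rw [← Ideal.jacobson_bot, Ideal.mem_jacobson_iff]
  intro y
  obtain ⟨u, hu⟩ := hx y
  refine ⟨(u⁻¹ : Rˣ), ?_⟩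
  have h1 : ((u⁻¹ : Rˣ) : R) * (1 + y * x) = 1 := by rw [← hu]; simp
  rw [Ideal.mem_bot, mul_assoc, sub_eq_zero, ← h1]
  noncomm_ring

end UnitalFacts

section Radical

variable (k : Type*) {A : Type*} [Field k] [NonUnitalRing A] [Module k A]
  [IsScalarTower k A A] [SMulCommClass k A A]

/-- An element `a` generates only quasi-regular left multiples iff it lies in the Jacobson
radical of the algebra obtained by adjoining an identity to `A`. -/
theorem forall_isQuasiregular_iff (a : A) :
    (∀ b : A, IsQuasiregular (b * a)) ↔
      (Unitization.inr a : Unitization k A) ∈ Ring.jacobson (Unitization k A) := by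
  constructor
  · intro h
    apply mem_jacobson_of_isUnit
    intro y
    obtain ⟨b, hb⟩ : ∃ b : A, (Unitization.inr b : Unitization k A) =
        -(y * Unitization.inr a * y) := by
      refine ⟨(-(y * Unitization.inr a * y)).snd, ?_⟩
      ext <;> simp
    have h1 := (h b).map (Unitization.inrNonUnitalAlgHom k A)
    have h2 := h1.isUnit_one_add
    have h3 : (1 : Unitization k A) + Unitization.inrNonUnitalAlgHom k A (b * a)
        = (1 + y * Unitization.inr a) * (1 - y * Unitization.inr a) := by
      change (1 : Unitization k A) + Unitization.inr (b * a) = _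
      rw [Unitization.inr_mul, hb]
      noncomm_ring
    rw [h3] at h2
    have hc : Commute ((1 : Unitization k A) + y * Unitization.inr a)
        (1 - y * Unitization.inr a) := by
      change _ * _ = _ * _
      noncomm_ring
    exact (hc.isUnit_mul_iff.mp h2).1
  · intro h b
    rw [← Unitization.isQuasiregular_inr_iff (R := k), isQuasiregular_iff_isUnit,
      Unitization.inr_mul]
    exact isUnit_one_add_of_mem_jacobson (Ideal.mul_mem_left _ _ h)

variable (A) in
/-- The Jacobson radical `J(A)` of a not necessarily unital algebra `A`: the set of all `a` such
that every left multiple `b * a` is quasi-regular. -/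
def jacobsonRadical : Submodule k A where
  carrier := {a | ∀ b : A, IsQuasiregular (b * a)}
  zero_mem' := fun b => by rw [mul_zero]; exact isQuasiregular_iff.mpr ⟨0, by simp⟩
  add_mem' := by
    intro x y hx hy
    rw [Set.mem_ofPred_eq, forall_isQuasiregular_iff k] at hx hy ⊢
    rw [Unitization.inr_add]
    exact add_mem hx hy
  smul_mem' := by
    intro c x hx b
    rw [mul_smul_comm, ← smul_mul_assoc]
    exact hx (c • b)

theorem mem_jacobsonRadical {a : A} :
    a ∈ jacobsonRadical k A ↔ ∀ b : A, IsQuasiregular (b * a) := Iff.rfl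

theorem mul_mem_jacobsonRadical_left (x : A) {a : A} (ha : a ∈ jacobsonRadical k A) :
    x * a ∈ jacobsonRadical k A := fun b => by
  rw [← mul_assoc]
  exact ha (b * x)

theorem mul_mem_jacobsonRadical_right {a : A} (x : A) (ha : a ∈ jacobsonRadical k A) :
    a * x ∈ jacobsonRadical k A := by
  rw [mem_jacobsonRadical, forall_isQuasiregular_iff k] at ha ⊢
  rw [Unitization.inr_mul]
  exact Ideal.mul_mem_right _ _ ha

variable (A) in
/-- The quotient algebra `A / J(A)`. -/
def RadicalQuotient : Type _ := A ⧸ jacobsonRadical k A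

namespace RadicalQuotient

instance instAddCommGroup : AddCommGroup (RadicalQuotient k A) :=
  inferInstanceAs (AddCommGroup (A ⧸ jacobsonRadical k A))

instance instModule : Module k (RadicalQuotient k A) :=
  inferInstanceAs (Module k (A ⧸ jacobsonRadical k A))

/-- The natural projection `A → A / J(A)`, as a linear map. -/
def proj : A →ₗ[k] RadicalQuotient k A := (jacobsonRadical k A).mkQ

theorem proj_surjective : Function.Surjective (proj k : A → RadicalQuotient k A) :=
  (jacobsonRadical k A).mkQ_surjective

theorem proj_eq_zero_iff (a : A) : proj k a = 0 ↔ a ∈ jacobsonRadical k A :=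
  Submodule.Quotient.mk_eq_zero _

/-- Multiplication of residue classes of representatives. -/
instance instMul : Mul (RadicalQuotient k A) where
  mul x y := Quotient.liftOn₂' x y (fun a b => proj k (a * b)) (by
    intro a₁ a₂ b₁ b₂ h₁ h₂
    rw [Submodule.quotientRel_def] at h₁ h₂
    rw [← sub_eq_zero, ← map_sub, proj_eq_zero_iff]
    have h : a₁ * a₂ - b₁ * b₂ = (a₁ - b₁) * a₂ + b₁ * (a₂ - b₂) := by
      noncomm_ring
    rw [h]
    exact add_mem (mul_mem_jacobsonRadical_right k _ h₁) (mul_mem_jacobsonRadical_left k _ h₂))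

theorem proj_mul (a b : A) : proj k (a * b) = proj k a * proj k b := rfl

instance instNonUnitalRing : NonUnitalRing (RadicalQuotient k A) where
  left_distrib x y z := by
    obtain ⟨a, rfl⟩ := proj_surjective k x
    obtain ⟨b, rfl⟩ := proj_surjective k y
    obtain ⟨c, rfl⟩ := proj_surjective k z
    simp only [← proj_mul, ← map_add, mul_add]
  right_distrib x y z := by
    obtain ⟨a, rfl⟩ := proj_surjective k x
    obtain ⟨b, rfl⟩ := proj_surjective k y
    obtain ⟨c, rfl⟩ := proj_surjective k z
    simp only [← proj_mul, ← map_add, add_mul]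
  zero_mul x := by
    obtain ⟨a, rfl⟩ := proj_surjective k x
    rw [← map_zero (proj k : A →ₗ[k] RadicalQuotient k A), ← proj_mul, zero_mul]
  mul_zero x := by
    obtain ⟨a, rfl⟩ := proj_surjective k x
    rw [← map_zero (proj k : A →ₗ[k] RadicalQuotient k A), ← proj_mul, mul_zero]
  mul_assoc x y z := by
    obtain ⟨a, rfl⟩ := proj_surjective k x
    obtain ⟨b, rfl⟩ := proj_surjective k y
    obtain ⟨c, rfl⟩ := proj_surjective k z
    simp only [← proj_mul, mul_assoc]

instance instIsScalarTower : IsScalarTower k (RadicalQuotient k A) (RadicalQuotient k A) where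
  smul_assoc c x y := by
    obtain ⟨a, rfl⟩ := proj_surjective k x
    obtain ⟨b, rfl⟩ := proj_surjective k y
    simp only [smul_eq_mul, ← map_smul, ← proj_mul, smul_mul_assoc]

instance instSMulCommClass : SMulCommClass k (RadicalQuotient k A) (RadicalQuotient k A) where
  smul_comm c x y := by
    obtain ⟨a, rfl⟩ := proj_surjective k x
    obtain ⟨b, rfl⟩ := proj_surjective k y
    simp only [smul_eq_mul, ← map_smul, ← proj_mul, mul_smul_comm]

end RadicalQuotient

end Radical

end AssocAlg

/-! In finite dimension the length is the height of the top element of the subalgebra lattice: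
dimension bounds all strict chains, and a longest chain admits no refinement. In this form length is
additive in short exact sequences (`len_eq_add`).

The radical is nilpotent. A hyperplane containing the products of a nilpotent algebra is a
subalgebra, so the radical contributes its dimension (`len_eq_finrank_of_filtration`). Additivity
leaves one matrix algebra, treated as `End_K(V)` with `n = dim_K V`, `d = [K : k]`, `L` the length
of `End_K(K)`. The claim is that its length is `f(n) = n - 1 + n(n-1)d/2 + nL`.

The stabilizer of a subspace of dimension `a` and codimension `b` is an extension of `End(W) ×
End(V/W)` by a square-zero ideal of dimension `abd`. Stabilizers of lines give the lower bound by
induction (`le_len_end`). For the upper bound (`len_end_le`) every proper subalgebra must have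
length below `f(n)`. A reducible one lies in a stabilizer, and `f(a) + f(b) + abd = f(n) - 1`. A
nonzero irreducible one is simple and unital, hence some `M_r(E)` with `n = rt` and `[E : k] ≤ td`.
If `t = 1`, then `E` embeds properly in an algebra isomorphic to `End_K(K)`; if `t ≥ 2`, the crude
estimate `l(E) ≤ 1 + [E : k]/2` suffices. -/

namespace AssocAlg

/-! ### Heights in ordered sets -/

section Order

/-- A chain below `g ⊥` can be continued by the image of a chain from `⊥` to `b`. This yields the
superadditive half of `len_eq_add`. -/
theorem height_add_height_le {α β : Type*} [Preorder α] [PartialOrder β] [OrderBot β]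
    {g : β → α} (hg : StrictMono g) (b : β) :
    Order.height (g ⊥) + Order.height b ≤ Order.height (g b) := by
  have key : ∀ (n : ℕ) (b : β), (n : ℕ∞) ≤ Order.height b →
      Order.height (g ⊥) + n ≤ Order.height (g b) := by
    intro n
    induction n with
    | zero => intro b _; simpa using Order.height_mono (hg.monotone bot_le)
    | succ n ih =>
      intro b hb
      obtain ⟨p, hp, hl⟩ := Order.exists_series_of_le_height b hb
      have hlt : p ⟨n, by omega⟩ < b := by
        rw [← hp]
        exact p.strictMono (by rw [Fin.lt_def]; simp [hl])
      have h1 : (n : ℕ∞) ≤ Order.height (p ⟨n, by omega⟩) :=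
        Order.index_le_height p ⟨n, by omega⟩
      calc Order.height (g ⊥) + ((n + 1 : ℕ) : ℕ∞)
          = Order.height (g ⊥) + n + 1 := by push_cast; rw [add_assoc]
        _ ≤ Order.height (g (p ⟨n, by omega⟩)) + 1 := by gcongr; exact ih _ h1
        _ ≤ _ := Order.height_add_one_le (hg hlt)
  rcases eq_or_ne (Order.height b) ⊤ with h | h
  · have : Order.height (g b) = ⊤ := by
      rw [ENat.eq_top_iff_forall_ge]
      exact fun n => le_add_self.trans (key n b (by simp [h]))
    simp [this]
  · lift Order.height b to ℕ using h with n hn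
    exact key n b hn.le

theorem height_le_of_strictMono {α : Type*} [Preorder α] {g : α → ℕ} (hg : StrictMono g) (a : α) :
    Order.height a ≤ g a := by
  simpa using Order.height_le_height_apply_of_strictMono g hg a

end Order

/-! ### Length as lattice height -/

section Len

set_option linter.unusedSectionVars false

variable (k : Type*) [Field k]
  (A : Type*) [NonUnitalRing A] [Module k A] [IsScalarTower k A A] [SMulCommClass k A A]
  {B : Type*} [NonUnitalRing B] [Module k B] [IsScalarTower k B B] [SMulCommClass k B B]
  {C : Type*} [NonUnitalRing C] [Module k C] [IsScalarTower k C C] [SMulCommClass k C C]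

/-- The length of an algebra as a natural number: the height of the top subalgebra. -/
noncomputable def len : ℕ := (Order.height (⊤ : NonUnitalSubalgebra k A)).toNat

variable {k A}

theorem finrank_strictMono [FiniteDimensional k A] :
    StrictMono fun S : NonUnitalSubalgebra k A => Module.finrank k S.toSubmodule := fun _ _ h =>
  Submodule.finrank_lt_finrank_of_lt h

theorem height_le_finrank [FiniteDimensional k A] (S : NonUnitalSubalgebra k A) :
    Order.height S ≤ Module.finrank k S.toSubmodule :=
  height_le_of_strictMono finrank_strictMono S

theorem height_ne_top [FiniteDimensional k A] (S : NonUnitalSubalgebra k A) :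
    Order.height S ≠ ⊤ :=
  ((height_le_finrank S).trans_lt (ENat.natCast_lt_top _)).ne

theorem toNat_height_strictMono [FiniteDimensional k A] :
    StrictMono fun S : NonUnitalSubalgebra k A => (Order.height S).toNat := fun S T h => by
  have := Order.height_add_one_le h
  rw [← ENat.natCast_toNat (height_ne_top S), ← ENat.natCast_toNat (height_ne_top T)] at this
  exact_mod_cast this

theorem height_top_eq_len [FiniteDimensional k A] :
    Order.height (⊤ : NonUnitalSubalgebra k A) = len k A :=
  (ENat.natCast_toNat (height_ne_top _)).symm

theorem map_strictMono {f : A →ₙₐ[k] B} (hf : Function.Injective f) :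
    StrictMono (NonUnitalSubalgebra.map f : NonUnitalSubalgebra k A → _) :=
  Monotone.strictMono_of_injective (fun _ _ => NonUnitalSubalgebra.map_mono)
    (NonUnitalSubalgebra.map_injective hf)

theorem comap_strictMono {f : A →ₙₐ[k] B} (hf : Function.Surjective f) :
    StrictMono (NonUnitalSubalgebra.comap f : NonUnitalSubalgebra k B → _) := by
  refine Monotone.strictMono_of_injective (fun S T h x hx => h hx) fun S T h => ?_
  ext y
  obtain ⟨x, rfl⟩ := hf y
  exact SetLike.ext_iff.mp h x

theorem height_map {f : A →ₙₐ[k] B} (hf : Function.Injective f) (S : NonUnitalSubalgebra k A) :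
    Order.height (S.map f) = Order.height S := by
  refine (Order.height_eq_of_strictMono _ (map_strictMono hf) (fun T U hU => ?_) S).symm
  have hUT : (U.comap f).map f = U := SetLike.coe_injective ?_
  · refine ⟨U.comap f, lt_of_le_of_ne (fun x hx => ?_) fun h => hU.ne (by rw [← hUT, h]), hUT⟩
    obtain ⟨y, hy, hxy⟩ := NonUnitalSubalgebra.mem_map.mp (hU.le hx)
    exact hf hxy ▸ hy
  rw [NonUnitalSubalgebra.coe_map, NonUnitalSubalgebra.coe_comap, Set.image_preimage_eq_iff]
  intro x hx
  obtain ⟨y, _, rfl⟩ := NonUnitalSubalgebra.mem_map.mp (hU.le hx)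
  exact ⟨y, rfl⟩

theorem height_range [FiniteDimensional k A] {f : A →ₙₐ[k] B} (hf : Function.Injective f) :
    Order.height (NonUnitalAlgHom.range f) = len k A := by
  rw [← NonUnitalAlgebra.map_top, height_map hf, height_top_eq_len]

theorem height_eq_len [FiniteDimensional k A] (S : NonUnitalSubalgebra k A) :
    Order.height S = len k S := by
  have : FiniteDimensional k S := inferInstanceAs (FiniteDimensional k S.toSubmodule)
  rw [← height_range (f := NonUnitalSubalgebraClass.subtype S) Subtype.val_injective,
    NonUnitalSubalgebra.range_val]

theorem len_le_of_injective [FiniteDimensional k A] [FiniteDimensional k B] {f : A →ₙₐ[k] B}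
    (hf : Function.Injective f) : len k A ≤ len k B := by
  have := Order.height_mono (le_top : NonUnitalAlgHom.range f ≤ ⊤)
  rw [height_range hf, height_top_eq_len] at this
  exact_mod_cast this

theorem len_lt_of_injective [FiniteDimensional k A] [FiniteDimensional k B] {f : A →ₙₐ[k] B}
    (hf : Function.Injective f) (hs : ¬ Function.Surjective f) : len k A < len k B := by
  have := Order.height_add_one_le (lt_top_iff_ne_top.mpr fun h =>
    hs ((NonUnitalAlgebra.range_eq_top (f := f)).mp h))
  rw [height_range hf, height_top_eq_len] at this
  exact_mod_cast this

theorem len_eq_of_bijective [FiniteDimensional k A] {f : A →ₙₐ[k] B}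
    (hf : Function.Bijective f) : len k A = len k B := by
  have : FiniteDimensional k B := Module.Finite.of_surjective (f : A →ₗ[k] B) hf.2
  have := height_range hf.1
  rw [(NonUnitalAlgebra.range_eq_top (f := f)).mpr hf.2, height_top_eq_len] at this
  exact_mod_cast this.symm

theorem len_le_finrank [FiniteDimensional k A] : len k A ≤ Module.finrank k A := by
  have := height_le_finrank (⊤ : NonUnitalSubalgebra k A)
  rw [height_top_eq_len, NonUnitalAlgebra.top_toSubmodule, finrank_top] at this
  exact_mod_cast this

theorem len_subalgebra_lt [FiniteDimensional k A] {S : NonUnitalSubalgebra k A} (h : S ≠ ⊤) :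
    len k S < len k A := by
  have := Order.height_add_one_le (lt_top_iff_ne_top.mpr h)
  rw [height_eq_len, height_top_eq_len] at this
  exact_mod_cast this

theorem len_le_of_forall_lt [FiniteDimensional k A] {m : ℕ}
    (h : ∀ S : NonUnitalSubalgebra k A, S ≠ ⊤ → len k S < m) : len k A ≤ m := by
  have : Order.height (⊤ : NonUnitalSubalgebra k A) ≤ m := by
    rw [Order.height_le_coe_iff]
    intro S hS
    rw [height_eq_len]
    exact_mod_cast h S hS.ne
  rw [height_top_eq_len] at this
  exact_mod_cast this

theorem len_pos [FiniteDimensional k A] [Nontrivial A] : 0 < len k A := by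
  refine (Nat.zero_le _).trans_lt (len_subalgebra_lt (S := ⊥) fun h => ?_)
  obtain ⟨a, ha⟩ := exists_ne (0 : A)
  exact ha (NonUnitalAlgebra.mem_bot.mp (h ▸ NonUnitalAlgebra.mem_top))

/-- Additivity of the length in short exact sequences. -/
theorem len_eq_add [FiniteDimensional k A] [FiniteDimensional k B]
    {f : B →ₙₐ[k] A} {g : A →ₙₐ[k] C} (hf : Function.Injective f) (hg : Function.Surjective g)
    (hfg : ∀ a, g a = 0 ↔ ∃ b, f b = a) : len k A = len k B + len k C := by
  have : FiniteDimensional k C := Module.Finite.of_surjective (g : A →ₗ[k] C) hg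
  have hgf : ∀ b, g (f b) = 0 := fun b => (hfg _).mpr ⟨b, rfl⟩
  apply le_antisymm
  -- Intersection with the kernel and image in the quotient together detect strict inclusions, so
  -- the sum of their heights is a strictly increasing rank function.
  · let r : NonUnitalSubalgebra k A → ℕ := fun S =>
      (Order.height (S.comap f)).toNat + (Order.height (S.map g)).toNat
    have hr : StrictMono r := by
      intro S T hST
      have h1 : S.comap f ≤ T.comap f := fun x hx => hST.le hx
      have h2 : S.map g ≤ T.map g := NonUnitalSubalgebra.map_mono hST.le
      rcases h1.lt_or_eq with h1' | h1'
      · exact add_lt_add_of_lt_of_le (toNat_height_strictMono h1') (toNat_height_strictMono.monotone h2)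
      rcases h2.lt_or_eq with h2' | h2'
      · exact add_lt_add_of_le_of_lt (toNat_height_strictMono.monotone h1) (toNat_height_strictMono h2')
      exfalso
      refine hST.not_ge fun t ht => ?_
      obtain ⟨s, hs, hst⟩ := NonUnitalSubalgebra.mem_map.mp
        (h2' ▸ NonUnitalSubalgebra.mem_map.mpr ⟨t, ht, rfl⟩ : g t ∈ S.map g)
      obtain ⟨b, hb⟩ := (hfg (t - s)).mp (by rw [map_sub, hst, sub_self])
      have hb' : b ∈ T.comap f := by
        rw [NonUnitalSubalgebra.mem_comap, hb]
        exact sub_mem ht (hST.le hs)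
      rw [← h1', NonUnitalSubalgebra.mem_comap, hb] at hb'
      simpa using add_mem hb' hs
    have h := height_le_of_strictMono hr ⊤
    have e1 : (⊤ : NonUnitalSubalgebra k A).comap f = ⊤ := by ext; simp
    have e2 : (⊤ : NonUnitalSubalgebra k A).map g = ⊤ := by
      rw [NonUnitalAlgebra.map_top, NonUnitalAlgebra.range_eq_top]; exact hg
    rw [height_top_eq_len] at h
    simp only [r, e1, e2] at h
    exact_mod_cast h
  -- Preimages of a chain in `C` continue a chain inside the kernel.
  · have h := height_add_height_le (comap_strictMono hg) ⊤
    have e1 : (⊥ : NonUnitalSubalgebra k C).comap g = NonUnitalAlgHom.range f := by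
      ext a
      rw [NonUnitalSubalgebra.mem_comap, NonUnitalAlgebra.mem_bot, hfg]
      exact Iff.rfl
    have e2 : (⊤ : NonUnitalSubalgebra k C).comap g = ⊤ := by ext; simp
    rw [e1, e2, height_range hf, height_top_eq_len, height_top_eq_len] at h
    exact_mod_cast h

theorem length_eq_len [FiniteDimensional k A] : length k A = len k A := by
  have hub : ∀ t ∈ chainLengths k A, t ≤ len k A := by
    rintro t ⟨c, hc0, hct, hc⟩
    -- Unrefinable chains descend while series ascend, hence the reversal of indices.
    let p : LTSeries (NonUnitalSubalgebra k A) :=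
      { length := t
        toFun := fun i => c i.rev
        step := fun i => by
          have := (hc i.rev).lt
          rwa [← Fin.rev_castSucc, ← Fin.rev_succ] at this }
    have h := Order.length_le_height_last (p := p)
    have hl : p.last = ⊤ := by
      change c (Fin.last t).rev = ⊤
      rw [Fin.rev_last, hc0]
    rw [hl, height_top_eq_len] at h
    exact_mod_cast h
  have hmem : len k A ∈ chainLengths k A := by
    obtain ⟨p, hp, hl⟩ := Order.exists_series_of_height_eq_coe _ (height_top_eq_len (k := k) (A := A))
    have hh : (p.length : ℕ∞) = Order.height p.last := by
      rw [hp, hl, height_top_eq_len]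
    -- In a longest series the `i`-th term has height exactly `i`, so nothing fits strictly between
    -- consecutive terms.
    have hi := Order.height_eq_index_of_length_eq_height_last hh
    rw [← hl]
    refine ⟨fun i => p i.rev, ?_, ?_, fun i => ⟨?_, fun S h1 h2 => ?_⟩⟩
    · simpa using! hp
    · have := hi 0
      simp only [Fin.val_zero, Nat.cast_zero, Order.height_eq_zero] at this
      simpa using isMin_iff_eq_bot.mp this
    · exact p.strictMono (by simp)
    · have a1 := Order.height_add_one_le h1
      have a2 := Order.height_add_one_le h2
      rw [hi] at a1 a2
      rw [height_eq_len] at a1 a2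
      norm_cast at a1 a2
      simp only [Fin.val_rev, Fin.val_succ, Fin.val_castSucc] at a1 a2
      omega
  have hex : ∃ t : ℕ, IsGreatest (chainLengths k A) t := ⟨_, hmem, hub⟩
  rw [length, dif_pos hex]
  exact congrArg _ (hex.choose_spec.unique ⟨hmem, hub⟩)

end Len

section AlgHom

variable {k : Type*} [Field k] {A : Type*} [Ring A] [Algebra k A] [FiniteDimensional k A]
  {B : Type*} [Ring B] [Algebra k B]

theorem len_eq_of_algEquiv (e : A ≃ₐ[k] B) : len k A = len k B :=
  len_eq_of_bijective (f := (AlgHomClass.toAlgHom e).toNonUnitalAlgHom) e.bijective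

theorem len_lt_of_algHom [FiniteDimensional k B] (f : A →ₐ[k] B) (hf : Function.Injective f)
    (hs : ¬ Function.Surjective f) : len k A < len k B :=
  len_lt_of_injective (f := f.toNonUnitalAlgHom) hf hs

end AlgHom

/-! ### Nilpotent algebras -/

section Nilpotent

universe u

variable {k : Type*} [Field k]

/-- If a finite-dimensional algebra has a filtration by subspaces, from the whole algebra to zero,
such that right multiplication increases the filtration degree, then its length is its dimension. -/
theorem len_eq_finrank_of_filtration {A : Type u} [NonUnitalRing A] [Module k A]
    [IsScalarTower k A A] [SMulCommClass k A A] [FiniteDimensional k A]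
    (F : ℕ → Submodule k A) (m : ℕ) (h0 : F 0 = ⊤) (hm : F m = ⊥)
    (hF : ∀ i, ∀ x ∈ F i, ∀ y, x * y ∈ F (i + 1)) : len k A = Module.finrank k A := by
  refine le_antisymm len_le_finrank ?_
  induction hd : Module.finrank k A generalizing A with
  | zero => exact Nat.zero_le _
  | succ d ih =>
    let P : Submodule k A := Submodule.span k {z | ∃ x y, x * y = z}
    -- If products spanned `A`, every `F i` would be everything, including `F m = ⊥`.
    have hP : P ≠ ⊤ := by
      intro hP
      have hall : ∀ i, F i = ⊤ := by
        intro i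
        induction i with
        | zero => exact h0
        | succ i ihi =>
          rw [eq_top_iff, ← hP]
          refine Submodule.span_le.mpr ?_
          rintro _ ⟨x, y, rfl⟩
          exact hF i x (ihi ▸ Submodule.mem_top) y
      have : (⊥ : Submodule k A) = ⊤ := by rw [← hm, hall]
      rw [← finrank_top (R := k) (M := A), ← this, finrank_bot] at hd
      omega
    obtain ⟨H, hH, hPH⟩ := (eq_top_or_exists_le_coatom P).resolve_left hP
    -- A subspace containing all products is closed under multiplication, so a hyperplane above `P`
    -- serves for the induction.
    let S : NonUnitalSubalgebra k A := H.toNonUnitalSubalgebra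
      fun x y _ _ => hPH (Submodule.subset_span ⟨x, y, rfl⟩)
    have : FiniteDimensional k S := inferInstanceAs (FiniteDimensional k H)
    have hS : S ≠ ⊤ := fun h => hH.1 (by
      rw [← NonUnitalAlgebra.top_toSubmodule, ← h]; rfl)
    obtain ⟨x, hx⟩ : ∃ x, x ∉ H := by
      by_contra! h
      exact hH.1 (Submodule.eq_top_iff'.mpr h)
    have hsup : H ⊔ Submodule.span k {x} = ⊤ := hH.2 _ (by simpa using hx)
    have hlt : Module.finrank k H < Module.finrank k A := Submodule.finrank_lt hH.1
    have hle := Submodule.finrank_add_le_finrank_add_finrank H (Submodule.span k {x})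
    rw [hsup, finrank_top] at hle
    have h1 := finrank_span_singleton (K := k) fun h : x = 0 => hx (h ▸ zero_mem H)
    have hHd : Module.finrank k S = d := by
      change Module.finrank k H = d
      omega
    let ι : S →ₗ[k] A := (NonUnitalSubalgebraClass.subtype S : S →ₙₐ[k] A)
    have := ih (A := S) (fun i => (F i).comap ι) (by rw [h0, Submodule.comap_top])
      (by rw [hm]; exact LinearMap.ker_eq_bot.mpr Subtype.val_injective)
      (fun i x hx y => hF i x hx y) hHd
    have := len_subalgebra_lt hS
    omega

end Nilpotent

/-! ### Direct products -/

section Prod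

universe u v

variable {k : Type*} [Field k]

theorem len_prod (A : Type*) [NonUnitalRing A] [Module k A] [IsScalarTower k A A]
    [SMulCommClass k A A] [FiniteDimensional k A] (B : Type*) [NonUnitalRing B] [Module k B]
    [IsScalarTower k B B] [SMulCommClass k B B] [FiniteDimensional k B] :
    len k (A × B) = len k A + len k B := by
  refine len_eq_add (f := NonUnitalAlgHom.inl k A B) (g := NonUnitalAlgHom.snd k A B)
    (fun x y h => by simpa using h) Prod.snd_surjective fun ⟨a, b⟩ => ?_
  simp [NonUnitalAlgHom.inl_apply, eq_comm]

theorem len_pi {ι : Type u} [Fintype ι] (A : ι → Type v) [∀ i, NonUnitalRing (A i)]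
    [∀ i, Module k (A i)] [∀ i, IsScalarTower k (A i) (A i)] [∀ i, SMulCommClass k (A i) (A i)]
    [∀ i, FiniteDimensional k (A i)] : len k (∀ i, A i) = ∑ i, len k (A i) := by
  revert A
  refine Fintype.induction_empty_option (P := fun ι [Fintype ι] => ∀ (A : ι → Type v)
    [∀ i, NonUnitalRing (A i)] [∀ i, Module k (A i)] [∀ i, IsScalarTower k (A i) (A i)]
    [∀ i, SMulCommClass k (A i) (A i)] [∀ i, FiniteDimensional k (A i)],
    len k (∀ i, A i) = ∑ i, len k (A i)) ?_ ?_ ?_ ι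
  · intro α β _ e h A _ _ _ _ _
    let : Fintype α := Fintype.ofEquiv β e.symm
    let f : (∀ i, A i) →ₙₐ[k] (∀ i, A (e i)) :=
      { toFun := fun x i => x (e i)
        map_smul' := fun _ _ => rfl
        map_zero' := rfl
        map_add' := fun _ _ => rfl
        map_mul' := fun _ _ => rfl }
    have hf : Function.Bijective f := (Equiv.piCongrLeft A e).symm.bijective
    rw [len_eq_of_bijective hf, h]
    exact e.sum_comp fun i => len k (A i)
  · intro A _ _ _ _ _
    have := len_le_finrank (k := k) (A := ∀ i, A i)
    rw [Module.finrank_zero_of_subsingleton] at this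
    simpa using this
  · intro α _ h A _ _ _ _ _
    let f : (A none × ∀ i, A (some i)) →ₙₐ[k] (∀ i, A i) :=
      { toFun := fun x i => match i with
          | none => x.1
          | some i => x.2 i
        map_smul' := fun _ _ => by ext (_ | _) <;> rfl
        map_zero' := by ext (_ | _) <;> rfl
        map_add' := fun _ _ => by ext (_ | _) <;> rfl
        map_mul' := fun _ _ => by ext (_ | _) <;> rfl }
    have hf : Function.Bijective f :=
      ⟨fun x y hxy => Prod.ext (congrFun hxy none) (funext fun i => congrFun hxy (some i)),
        fun y => ⟨(y none, fun i => y (some i)), by ext (_ | _) <;> rfl⟩⟩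
    rw [← len_eq_of_bijective hf, len_prod, h, Fintype.sum_option]

end Prod

/-! ### Subalgebras of division algebras -/

section Division

variable {k : Type*} [Field k] {E : Type*} [DivisionRing E] [Algebra k E] [FiniteDimensional k E]

/-- For `y` outside `S`, the spaces `S` and `Sy` have equal dimension and meet in zero. If `0 ≠ cy ∈
S` with `c ∈ S`, left multiplication by `c` is injective on `S`, hence onto; then `cy = cz` with `z
∈ S` forces `y = z`. -/
theorem two_mul_finrank_le_of_ne_top {S : NonUnitalSubalgebra k E} (hS : S ≠ ⊤) :
    2 * Module.finrank k S.toSubmodule ≤ Module.finrank k E := by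
  obtain ⟨y, hy⟩ : ∃ y, y ∉ S := by
    by_contra! h
    exact hS (NonUnitalAlgebra.eq_top_iff.mpr h)
  have hy0 : y ≠ 0 := fun h => hy (h ▸ zero_mem S)
  let T : Submodule k E := S.toSubmodule.map (LinearMap.mulRight k y)
  have hT : Module.finrank k T = Module.finrank k S.toSubmodule :=
    (Submodule.equivMapOfInjective _ (mul_left_injective₀ hy0) _).finrank_eq.symm
  have hST : S.toSubmodule ⊓ T = ⊥ := by
    rw [eq_bot_iff]
    rintro _ ⟨hc, c, hcS, rfl⟩
    simp only [LinearMap.mulRight_apply, Submodule.mem_bot]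
    by_contra hne
    have hc0 : c ≠ 0 := fun h => hne (by rw [h, zero_mul])
    let m : S.toSubmodule →ₗ[k] S.toSubmodule :=
      (LinearMap.mulLeft k c).restrict fun z hz => S.mul_mem hcS hz
    have hm : Function.Injective m := fun a b hab =>
      Subtype.ext (mul_right_injective₀ hc0 (congrArg Subtype.val hab))
    obtain ⟨z, hz⟩ := LinearMap.surjective_of_injective hm ⟨c * y, hc⟩
    have : (z : E) = y := mul_right_injective₀ hc0 (congrArg Subtype.val hz)
    exact hy (this ▸ z.2)
  have h := Submodule.finrank_sup_add_finrank_inf_eq S.toSubmodule T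
  rw [hST, finrank_bot, hT] at h
  have := Submodule.finrank_le (S.toSubmodule ⊔ T)
  omega

theorem two_mul_len_le : 2 * len k E ≤ 2 + Module.finrank k E := by
  have : len k E ≤ 1 + Module.finrank k E / 2 := by
    refine len_le_of_forall_lt fun S hS => ?_
    have h1 := two_mul_finrank_le_of_ne_top hS
    have : FiniteDimensional k S := inferInstanceAs (FiniteDimensional k S.toSubmodule)
    have h2 : len k S ≤ Module.finrank k S.toSubmodule := len_le_finrank
    omega
  omega

end Division

/-! ### Endomorphism algebras, stabilizers and the lower bound -/

section EndAlgebra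

variable (k : Type*) [Field k] {K : Type*} [DivisionRing K] [Algebra k K] [FiniteDimensional k K]
  {V : Type*} [AddCommGroup V] [Module K V] [Module k V] [IsScalarTower k K V] [Module.Finite K V]
  {U : Type*} [AddCommGroup U] [Module K U] [Module k U] [IsScalarTower k K U] [Module.Finite K U]

set_option linter.unusedSectionVars false

theorem finiteDimensional_hom : FiniteDimensional k (V →ₗ[K] U) :=
  have : FiniteDimensional k U := Module.Finite.trans K U
  Module.Finite.equiv ((Module.finBasis K V).constr k (M' := U))

theorem finrank_hom : Module.finrank k (V →ₗ[K] U) =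
    Module.finrank K V * Module.finrank K U * Module.finrank k K := by
  have : FiniteDimensional k U := Module.Finite.trans K U
  rw [← ((Module.finBasis K V).constr k (M' := U)).finrank_eq, Module.finrank_pi_fintype]
  rw [← Module.finrank_mul_finrank k K U]
  simp only [Finset.sum_const, Finset.card_univ, Fintype.card_fin, smul_eq_mul]
  ring

theorem len_end_congr (h : Module.finrank K V = Module.finrank K U) :
    len k (Module.End K V) = len k (Module.End K U) := by
  have := finiteDimensional_hom k (K := K) (V := V) (U := V)
  exact len_eq_of_algEquiv ((LinearEquiv.ofFinrankEq V U h).conjAlgEquiv k)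

/-- The subalgebra of endomorphisms preserving a subspace. -/
def stabilizer (W : Submodule K V) : NonUnitalSubalgebra k (Module.End K V) where
  carrier := {f | ∀ w ∈ W, f w ∈ W}
  zero_mem' := fun _ _ => W.zero_mem
  add_mem' := fun hf hg w hw => W.add_mem (hf w hw) (hg w hw)
  mul_mem' := fun hf hg w hw => hf _ (hg w hw)
  smul_mem' := fun c _ hf w hw => W.smul_of_tower_mem c (hf w hw)

/-- The subalgebra of endomorphisms killing a subspace and mapping into it. -/
def stabilizerRadical (W : Submodule K V) : NonUnitalSubalgebra k (Module.End K V) where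
  carrier := {f | (∀ v, f v ∈ W) ∧ ∀ w ∈ W, f w = 0}
  zero_mem' := ⟨fun _ => W.zero_mem, fun _ _ => rfl⟩
  add_mem' := fun hf hg => ⟨fun v => W.add_mem (hf.1 v) (hg.1 v), fun w hw => by
    rw [LinearMap.add_apply, hf.2 w hw, hg.2 w hw, add_zero]⟩
  mul_mem' := fun {f g} hf hg => ⟨fun v => hf.1 _, fun w hw => by
    rw [Module.End.mul_apply, hg.2 w hw, map_zero]⟩
  smul_mem' := fun c _ hf => ⟨fun v => W.smul_of_tower_mem c (hf.1 v), fun w hw => by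
    rw [LinearMap.smul_apply, hf.2 w hw, smul_zero]⟩

theorem stabilizerRadical_le (W : Submodule K V) : stabilizerRadical k W ≤ stabilizer k W :=
  fun _ hf w _ => hf.1 w

/-- The action of the stabilizer of a subspace on the subspace and on the quotient. -/
def stabilizerHom (W : Submodule K V) :
    stabilizer k W →ₙₐ[k] Module.End K W × Module.End K (V ⧸ W) where
  toFun f := (f.1.restrict f.2, W.mapQ W f.1 f.2)
  map_smul' _ _ := Prod.ext rfl (by ext; rfl)
  map_zero' := Prod.ext rfl (by ext; rfl)
  map_add' _ _ := Prod.ext rfl (by ext; rfl)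
  map_mul' _ _ := Prod.ext rfl (by ext; rfl)

theorem stabilizerHom_surjective (W : Submodule K V) :
    Function.Surjective (stabilizerHom k W) := by
  rintro ⟨p, q⟩
  obtain ⟨r, hr⟩ := W.subtype.exists_leftInverse_of_injective W.ker_subtype
  obtain ⟨s, hs⟩ := W.mkQ.exists_rightInverse_of_surjective W.range_mkQ
  have hW : ∀ w : W, (W.subtype ∘ₗ p ∘ₗ r + s ∘ₗ q ∘ₗ W.mkQ) w = p w := fun w => by
    have h1 : r w = w := LinearMap.congr_fun hr w
    have h2 : W.mkQ w = 0 := (Submodule.Quotient.mk_eq_zero W).mpr w.2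
    simp only [LinearMap.add_apply, LinearMap.comp_apply, h1, h2, map_zero, add_zero]
    rfl
  refine ⟨⟨W.subtype ∘ₗ p ∘ₗ r + s ∘ₗ q ∘ₗ W.mkQ, fun w hw => ?_⟩, Prod.ext ?_ ?_⟩
  · rw [hW ⟨w, hw⟩]
    exact (p _).2
  · ext w
    exact hW w
  · ext v
    have h1 : W.mkQ (s (q (W.mkQ v))) = q (W.mkQ v) := LinearMap.congr_fun hs _
    have h2 : W.mkQ (W.subtype (p (r v))) = 0 := (Submodule.Quotient.mk_eq_zero W).mpr (p (r v)).2
    change W.mkQ (W.subtype (p (r v)) + s (q (W.mkQ v))) = q (W.mkQ v)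
    rw [map_add, h1, h2, zero_add]

/-- These endomorphisms are exactly the maps `V ⧸ W → W`, composed with projection and inclusion. -/
theorem finrank_stabilizerRadical (W : Submodule K V) :
    Module.finrank k (stabilizerRadical k W) =
      Module.finrank K W * Module.finrank K (V ⧸ W) * Module.finrank k K := by
  let φ : ((V ⧸ W) →ₗ[K] W) →ₗ[k] stabilizerRadical k W :=
    { toFun := fun h => ⟨W.subtype ∘ₗ h ∘ₗ W.mkQ, fun v => (h _).2, fun w hw => by
        simp [(Submodule.Quotient.mk_eq_zero W).mpr hw]⟩
      map_add' := fun _ _ => rfl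
      map_smul' := fun _ _ => rfl }
  have hφ : Function.Bijective φ := by
    constructor
    · intro a b hab
      ext v
      exact LinearMap.congr_fun (congrArg Subtype.val hab) v
    · rintro ⟨f, hf1, hf2⟩
      refine ⟨W.liftQ (f.codRestrict W hf1) fun w hw => Subtype.ext (hf2 w hw), ?_⟩
      rfl
  rw [← (LinearEquiv.ofBijective φ hφ).finrank_eq, finrank_hom]
  ring

theorem len_stabilizer (W : Submodule K V) : len k (stabilizer k W) =
    len k (Module.End K W) + len k (Module.End K (V ⧸ W)) +
      Module.finrank K W * Module.finrank K (V ⧸ W) * Module.finrank k K := by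
  have := finiteDimensional_hom k (K := K) (V := V) (U := V)
  have := finiteDimensional_hom k (K := K) (V := W) (U := W)
  have := finiteDimensional_hom k (K := K) (V := V ⧸ W) (U := V ⧸ W)
  have : FiniteDimensional k (stabilizer k W) :=
    inferInstanceAs (FiniteDimensional k (stabilizer k W).toSubmodule)
  have : FiniteDimensional k (stabilizerRadical k W) :=
    inferInstanceAs (FiniteDimensional k (stabilizerRadical k W).toSubmodule)
  rw [len_eq_add (NonUnitalSubalgebra.inclusion_injective (stabilizerRadical_le k W))
    (stabilizerHom_surjective k W), len_prod, ← finrank_stabilizerRadical k W,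
    -- The kernel has square zero, so one filtration step is enough.
    len_eq_finrank_of_filtration (A := stabilizerRadical k W) (fun i => if i = 0 then ⊤ else ⊥) 1
      (if_pos rfl) (if_neg one_ne_zero), add_comm]
  · intro i x _ y
    have : x * y = 0 := Subtype.ext (LinearMap.ext fun v => x.2.2 _ (y.2.1 v))
    rw [this]
    exact zero_mem _
  · intro f
    constructor
    · intro h
      rw [Prod.ext_iff] at h
      refine ⟨⟨f.1, fun v => ?_, fun w hw => ?_⟩, rfl⟩
      · exact (Submodule.Quotient.mk_eq_zero W).mp (LinearMap.congr_fun h.2 (W.mkQ v))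
      · exact congrArg Subtype.val (LinearMap.congr_fun h.1 ⟨w, hw⟩)
    · rintro ⟨b, rfl⟩
      refine Prod.ext (LinearMap.ext fun w => Subtype.ext (b.2.2 w w.2)) ?_
      ext v
      exact (Submodule.Quotient.mk_eq_zero W).mpr (b.2.1 v)

/-- Some endomorphism carries a nonzero vector of `W` outside `W`. -/
theorem stabilizer_ne_top {W : Submodule K V} (h0 : W ≠ ⊥) (h1 : W ≠ ⊤) :
    stabilizer k W ≠ ⊤ := by
  obtain ⟨w, hw, hw0⟩ := W.exists_mem_ne_zero_of_ne_bot h0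
  obtain ⟨u, hu⟩ : ∃ u, u ∉ W := by
    by_contra! h
    exact h1 (Submodule.eq_top_iff'.mpr h)
  let e := LinearEquiv.toSpanNonzeroSingleton K V w hw0
  obtain ⟨g, hg⟩ := LinearMap.exists_extend (LinearMap.toSpanSingleton K V u ∘ₗ e.symm.toLinearMap)
  have hgw : g w = u := by
    have h := LinearMap.congr_fun hg (e 1)
    have h1 : ((e 1 : Submodule.span K {w}) : V) = w := one_smul K w
    simpa only [LinearMap.comp_apply, Submodule.subtype_apply, h1, LinearEquiv.coe_coe,
      LinearEquiv.symm_apply_apply, LinearMap.toSpanSingleton_apply, one_smul] using h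
  intro h
  have : g ∈ stabilizer k W := h ▸ NonUnitalAlgebra.mem_top
  exact hu (hgw ▸ this w hw)

/-- Induction through the stabilizer of a line; its properness supplies one extra unit at each step.
Writing the dimension as `n + 1` avoids truncated subtraction. -/
theorem le_len_end {n : ℕ} (hn : Module.finrank K V = n + 1) :
    n + (n + 1).choose 2 * Module.finrank k K + (n + 1) * len k (Module.End K K) ≤
      len k (Module.End K V) := by
  induction n generalizing V with
  | zero =>
    simp [len_end_congr k (V := V) (U := K) (by rw [hn, Module.finrank_self])]
  | succ n ih =>
    have : Nontrivial V := Module.nontrivial_of_finrank_pos (R := K) (by omega)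
    obtain ⟨v, hv⟩ := exists_ne (0 : V)
    let W := Submodule.span K {v}
    have hW : Module.finrank K W = 1 := finrank_span_singleton hv
    have hQ : Module.finrank K (V ⧸ W) = n + 1 := by
      have := W.finrank_quotient_add_finrank
      omega
    have h1 := ih hQ
    have h2 := len_stabilizer k W
    have h3 := len_end_congr k (K := K) (V := W) (U := K) (by rw [hW, Module.finrank_self])
    have := finiteDimensional_hom k (K := K) (V := V) (U := V)
    have h4 := len_subalgebra_lt (stabilizer_ne_top k (W := W)
      (fun h => by rw [h, finrank_bot] at hW; omega)
      (fun h => by rw [h, finrank_top] at hW; omega))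
    rw [hW, hQ, h3] at h2
    rw [Nat.choose_succ_succ' (n + 1) 1, Nat.choose_one_right]
    linarith

end EndAlgebra

/-! ### Irreducible algebras of endomorphisms -/

section Irreducible

variable {k : Type*} [Field k] {K : Type*} [DivisionRing K] [Algebra k K]
  {V : Type*} [AddCommGroup V] [Module K V] [Module k V] [IsScalarTower k K V]

/-- The span of `IV` is invariant and nonzero, hence all of `V`; since `x` kills it, `x = 0`. -/
theorem eq_zero_of_forall_mul_eq_zero {R : Subalgebra k (Module.End K V)}
    (hR : ∀ W : Submodule K V, (∀ f ∈ R, ∀ w ∈ W, f w ∈ W) → W = ⊥ ∨ W = ⊤)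
    {I : Ideal R} (hI : I ≠ ⊥) {x : R} (hx : ∀ i ∈ I, x * i = 0) : x = 0 := by
  let W : Submodule K V := Submodule.span K {v | ∃ i ∈ I, ∃ u, v = (i : Module.End K V) u}
  have hinv : ∀ f ∈ R, ∀ w ∈ W, f w ∈ W := by
    intro f hf w hw
    refine (Submodule.span_le (p := W.comap f)).mpr ?_ hw
    rintro _ ⟨i, hi, u, rfl⟩
    exact Submodule.subset_span ⟨⟨f, hf⟩ * i, I.mul_mem_left _ hi, u, rfl⟩
  rcases hR W hinv with h | h
  · refine absurd ((Submodule.eq_bot_iff I).mpr fun i hi => Subtype.ext ?_) hI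
    ext u
    exact (Submodule.mem_bot K).mp (h ▸ Submodule.subset_span ⟨i, hi, u, rfl⟩)
  · refine Subtype.ext (LinearMap.ker_eq_top.mp (eq_top_iff.mpr (h ▸ ?_)))
    refine Submodule.span_le.mpr ?_
    rintro _ ⟨i, hi, u, rfl⟩
    exact LinearMap.congr_fun (congrArg Subtype.val (hx i hi)) u

/-- A finite-dimensional irreducible algebra of endomorphisms is simple. -/
theorem isSimpleRing_of_irreducible [Nontrivial V] {R : Subalgebra k (Module.End K V)}
    [FiniteDimensional k R]
    (hR : ∀ W : Submodule K V, (∀ f ∈ R, ∀ w ∈ W, f w ∈ W) → W = ⊥ ∨ W = ⊤) :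
    IsSimpleRing R := by
  have : IsArtinianRing R := IsArtinianRing.of_finite k R
  have : IsSemisimpleRing R := by
    rw [IsArtinianRing.isSemisimpleRing_iff_jacobson]
    by_contra hJ
    -- If the radical `J` is nonzero, `Jⁿ · J = 0` would force `Jⁿ = 0`; so no power vanishes,
    -- contradicting nilpotency.
    have hpow : ∀ n, (Ring.jacobson R) ^ n ≠ ⊥ := by
      intro n
      induction n with
      | zero => rw [Submodule.pow_zero, Ideal.one_eq_top]; exact top_ne_bot
      | succ n ih =>
        intro h
        refine ih ((Submodule.eq_bot_iff _).mpr fun x hx =>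
          eq_zero_of_forall_mul_eq_zero hR hJ fun i hi => ?_)
        rw [← Ideal.mem_bot, ← h, Submodule.pow_succ]
        exact Ideal.mul_mem_mul hx hi
    obtain ⟨n, hn⟩ := IsSemiprimaryRing.isNilpotent (R := R)
    exact hpow n hn
  refine ⟨⟨fun I => ?_⟩⟩
  by_cases hI : I = ⊥
  · exact Or.inl hI
  refine Or.inr ?_
  have hI' : I.asIdeal ≠ ⊥ := by
    intro h
    refine hI (TwoSidedIdeal.ext fun x => ?_)
    rw [← TwoSidedIdeal.mem_asIdeal, h, Ideal.mem_bot, TwoSidedIdeal.mem_bot]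
  obtain ⟨L, hL⟩ := exists_isCompl I.asIdeal
  -- For a two-sided `I` with complementary left ideal `L`, the product `IL` lies in `I ∩ L = 0`; a
  -- nonzero `L` would make `I` zero.
  have hL0 : L = ⊥ := by
    by_contra hL0
    refine hI' ((Submodule.eq_bot_iff _).mpr fun i hi =>
      eq_zero_of_forall_mul_eq_zero hR hL0 fun l hl => ?_)
    exact (Submodule.disjoint_def.mp hL.disjoint) _
      (TwoSidedIdeal.mem_asIdeal.mpr (I.mul_mem_right _ _ (TwoSidedIdeal.mem_asIdeal.mp hi)))
      (L.mul_mem_left _ hl)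
  have htop : I.asIdeal = ⊤ := by simpa [hL0] using hL.codisjoint.eq_top
  refine TwoSidedIdeal.ext fun x => ?_
  rw [← TwoSidedIdeal.mem_asIdeal, htop]
  simp

/-- A nonzero irreducible algebra of endomorphisms contains the identity. -/
theorem mem_of_mem_adjoin [FiniteDimensional k (Module.End K V)]
    {B : NonUnitalSubalgebra k (Module.End K V)} (hB : B ≠ ⊥)
    [IsSimpleRing (Algebra.adjoin k (B : Set (Module.End K V)))]
    {x : Module.End K V} (hx : x ∈ Algebra.adjoin k (B : Set (Module.End K V))) : x ∈ B := by
  have hl : ∀ r ∈ Algebra.adjoin k (B : Set (Module.End K V)), ∀ b ∈ B, r * b ∈ B := by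
    intro r hr
    induction hr using Algebra.adjoin_induction with
    | mem x hx => exact fun b hb => B.mul_mem hx hb
    | algebraMap c => exact fun b hb => by rw [← Algebra.smul_def]; exact B.smul_mem' c hb
    | add x y _ _ hx hy => exact fun b hb => by rw [add_mul]; exact B.add_mem (hx b hb) (hy b hb)
    | mul x y _ _ hx hy => exact fun b hb => by rw [mul_assoc]; exact hx _ (hy b hb)
  have hr : ∀ r ∈ Algebra.adjoin k (B : Set (Module.End K V)), ∀ b ∈ B, b * r ∈ B := by
    intro r hr
    induction hr using Algebra.adjoin_induction with
    | mem x hx => exact fun b hb => B.mul_mem hb hx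
    | algebraMap c =>
      exact fun b hb => by rw [← Algebra.commutes, ← Algebra.smul_def]; exact B.smul_mem' c hb
    | add x y _ _ hx hy => exact fun b hb => by rw [mul_add]; exact B.add_mem (hx b hb) (hy b hb)
    | mul x y _ _ hx hy => exact fun b hb => by rw [← mul_assoc]; exact hy _ (hx b hb)
  -- `B` is a nonzero two-sided ideal of the simple unital algebra it generates, so it is that whole
  -- algebra.
  let I : TwoSidedIdeal (Algebra.adjoin k (B : Set (Module.End K V))) :=
    TwoSidedIdeal.mk' {y | (y : Module.End K V) ∈ B} B.zero_mem (fun hx hy => B.add_mem hx hy)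
      (fun hx => neg_mem (S := NonUnitalSubalgebra k (Module.End K V)) hx)
      (fun {x y} hy => hl x x.2 y hy) (fun {x y} hx => hr y y.2 x hx)
  have hmem : ∀ y, y ∈ I ↔ (y : Module.End K V) ∈ B := fun y => TwoSidedIdeal.mem_mk' ..
  have hI : I = ⊤ := by
    refine (eq_bot_or_eq_top I).resolve_left fun h => hB ((eq_bot_iff).mpr fun b hb => ?_)
    have : (⟨b, Algebra.subset_adjoin hb⟩ : Algebra.adjoin k (B : Set (Module.End K V))) ∈ I :=
      (hmem _).mpr hb
    rw [h, TwoSidedIdeal.mem_bot] at this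
    exact NonUnitalAlgebra.mem_bot.mpr (congrArg Subtype.val this)
  exact (hmem ⟨x, hx⟩).mp (hI ▸ TwoSidedIdeal.mem_top _)

end Irreducible

/-! ### Matrix algebras acting on a vector space -/

section MatrixAction

set_option linter.unusedSectionVars false

variable {k : Type*} [Field k] {K : Type*} [DivisionRing K] [Algebra k K] [FiniteDimensional k K]
  {V : Type*} [AddCommGroup V] [Module K V] [Module k V] [IsScalarTower k K V] [Module.Finite K V]
  {E : Type*} [DivisionRing E] [Algebra k E] {r : ℕ} [NeZero r]
  (φ : Matrix (Fin r) (Fin r) E →ₐ[k] Module.End K V)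

open Matrix in
theorem apply_single_mul (i j l : Fin r) (x y : E) (v : V) :
    φ (single i j x) (φ (single j l y) v) = φ (single i l (x * y)) v := by
  rw [← Module.End.mul_apply, ← map_mul, single_mul_single_same]

/-- The image of the first diagonal matrix unit. -/
def cornerSpace : Submodule K V := LinearMap.range (φ (Matrix.single 0 0 1))

theorem apply_single_mem (i : Fin r) (x : E) (v : V) :
    φ (Matrix.single 0 i x) v ∈ cornerSpace φ :=
  ⟨φ (Matrix.single 0 i x) v, by rw [apply_single_mul, one_mul]⟩

theorem apply_single_zero_of_mem {w : V} (hw : w ∈ cornerSpace φ) :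
    φ (Matrix.single 0 0 1) w = w := by
  obtain ⟨v, rfl⟩ := hw
  rw [apply_single_mul, one_mul]

/-- The space is a direct sum of copies of the image of a diagonal matrix unit. -/
def cornerEquiv : V ≃ₗ[K] (Fin r → cornerSpace φ) where
  toFun v i := ⟨φ (Matrix.single 0 i 1) v, apply_single_mem φ i 1 v⟩
  map_add' _ _ := funext fun _ => Subtype.ext (map_add _ _ _)
  map_smul' _ _ := funext fun _ => Subtype.ext (map_smul _ _ _)
  invFun w := ∑ i, φ (Matrix.single i 0 1) (w i)
  left_inv v := by
    simp only [apply_single_mul, one_mul]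
    rw [← LinearMap.sum_apply, ← map_sum]
    have : ∑ i : Fin r, Matrix.single i i (1 : E) = 1 := by
      rw [← Matrix.diagonal_one, Matrix.sum_single_eq_diagonal]
    rw [this, map_one, Module.End.one_apply]
  right_inv w := by
    funext i
    refine Subtype.ext ?_
    change φ (Matrix.single 0 i 1) (∑ j, φ (Matrix.single j 0 1) (w j)) = w i
    rw [map_sum, Finset.sum_eq_single i]
    · rw [apply_single_mul, one_mul, apply_single_zero_of_mem φ (w i).2]
    · intro j _ hj
      rw [← Module.End.mul_apply, ← map_mul, Matrix.single_mul_single_of_ne _ _ _ _ hj.symm,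
        map_zero, LinearMap.zero_apply]
    · simp

theorem finrank_eq_mul_finrank_cornerSpace :
    Module.finrank K V = r * Module.finrank K (cornerSpace φ) := by
  rw [(cornerEquiv φ).finrank_eq, Module.finrank_pi_fintype]
  simp

/-- The action of the coefficient division algebra on the image of a diagonal matrix unit. -/
def cornerHom : E →ₐ[k] Module.End K (cornerSpace φ) where
  toFun x := (φ (Matrix.single 0 0 x)).restrict fun w _ => apply_single_mem φ 0 x w
  map_one' := LinearMap.ext fun w => Subtype.ext (apply_single_zero_of_mem φ w.2)
  map_mul' x y := LinearMap.ext fun w => Subtype.ext (apply_single_mul φ 0 0 0 x y w).symm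
  map_zero' := LinearMap.ext fun w => Subtype.ext (by simp)
  map_add' x y := LinearMap.ext fun w => Subtype.ext (by
    simp [Matrix.single_add])
  commutes' c := LinearMap.ext fun w => Subtype.ext (by
    have : Matrix.single 0 0 (algebraMap k E c) =
        c • (Matrix.single 0 0 1 : Matrix (Fin r) (Fin r) E) := by
      rw [Matrix.smul_single, Algebra.algebraMap_eq_smul_one]
    change φ (Matrix.single 0 0 (algebraMap k E c)) w = c • (w : V)
    rw [this, map_smul, LinearMap.smul_apply, apply_single_zero_of_mem φ w.2])

/-- Evaluation at a nonzero corner vector is injective on the division algebra `E`. -/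
theorem finrank_le_finrank_cornerSpace_mul [Nontrivial (cornerSpace φ)] :
    Module.finrank k E ≤ Module.finrank K (cornerSpace φ) * Module.finrank k K := by
  have : FiniteDimensional k (cornerSpace φ) := Module.Finite.trans K _
  obtain ⟨w, hw⟩ := exists_ne (0 : cornerSpace φ)
  let ev : E →ₗ[k] cornerSpace φ :=
    { toFun := fun x => cornerHom φ x w
      map_add' := fun x y => by rw [map_add, LinearMap.add_apply]
      map_smul' := fun c x => by rw [map_smul, LinearMap.smul_apply]; rfl }
  have hev : Function.Injective ev := by
    rw [← LinearMap.ker_eq_bot, LinearMap.ker_eq_bot']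
    intro x hx
    by_contra hx0
    refine hw ?_
    have : cornerHom φ x⁻¹ (cornerHom φ x w) = w := by
      rw [← Module.End.mul_apply, ← map_mul, inv_mul_cancel₀ hx0, map_one, Module.End.one_apply]
    rw [← this]
    exact (congrArg _ hx).trans (map_zero _)
  have := LinearMap.finrank_le_finrank_of_injective hev
  rw [← Module.finrank_mul_finrank k K (cornerSpace φ)] at this
  linarith

/-- `E` embeds in the endomorphisms of a line over `K`, and the dimension inequality prevents
surjectivity. -/
theorem len_lt_len_end_of_finrank_cornerSpace_eq_one (h1 : Module.finrank K (cornerSpace φ) = 1)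
    (hlt : Module.finrank k E < Module.finrank k K) [FiniteDimensional k E] :
    len k E < len k (Module.End K K) := by
  have := finiteDimensional_hom k (K := K) (V := cornerSpace φ) (U := cornerSpace φ)
  have : Nontrivial (cornerSpace φ) := Module.nontrivial_of_finrank_pos (R := K) (by omega)
  rw [← len_end_congr k (K := K) (V := cornerSpace φ) (U := K) (by rw [h1, Module.finrank_self])]
  refine len_lt_of_algHom (cornerHom φ) (cornerHom φ).toRingHom.injective fun hs => ?_
  have h := LinearMap.finrank_le_finrank_of_surjective (f := (cornerHom φ).toLinearMap) hs
  rw [finrank_hom, h1] at h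
  omega

end MatrixAction

/-! ### Matrices as endomorphisms of column spaces over the opposite algebra -/

section MatrixEnd

variable (k : Type*) [Field k] (E : Type*) [DivisionRing E] [Algebra k E]

theorem exists_op_smul_one_eq (x : E) : ∃ c : Eᵐᵒᵖ, c • (1 : E) = x :=
  ⟨MulOpposite.op x, by simp⟩

theorem finrank_mulOpposite_self : Module.finrank Eᵐᵒᵖ E = 1 :=
  finrank_eq_one 1 one_ne_zero (exists_op_smul_one_eq E)

instance finite_mulOpposite_self : Module.Finite Eᵐᵒᵖ E :=
  Module.Finite.of_surjective (LinearMap.toSpanSingleton Eᵐᵒᵖ E 1) (exists_op_smul_one_eq E)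

theorem finrank_mulOpposite : Module.finrank k Eᵐᵒᵖ = Module.finrank k E :=
  (MulOpposite.opLinearEquiv k).finrank_eq.symm

/-- Matrices over a division algebra are the endomorphisms of the space of column vectors. -/
def matrixAlgEquivEnd (n : ℕ) :
    Matrix (Fin n) (Fin n) E ≃ₐ[k] Module.End Eᵐᵒᵖ (Fin n → E) :=
  (AlgEquiv.moduleEndSelfOp k (A := E)).mapMatrix.trans
    (endVecAlgEquivMatrixEnd (Fin n) k Eᵐᵒᵖ E).symm

theorem finrank_mulOpposite_pi (n : ℕ) : Module.finrank Eᵐᵒᵖ (Fin n → E) = n := by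
  rw [Module.finrank_pi_fintype]
  simp [finrank_mulOpposite_self]

theorem len_end_mulOpposite [FiniteDimensional k E] :
    len k (Module.End Eᵐᵒᵖ Eᵐᵒᵖ) = len k E := by
  have : FiniteDimensional k Eᵐᵒᵖ := Module.Finite.equiv (MulOpposite.opLinearEquiv k)
  rw [len_end_congr k (V := Eᵐᵒᵖ) (U := E)
    (by rw [finrank_mulOpposite_self, Module.finrank_self])]
  exact (len_eq_of_algEquiv (AlgEquiv.moduleEndSelfOp k)).symm

end MatrixEnd

/-! ### The upper bound and matrix algebras -/

section UpperBound

universe u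

/-- The numerical core of the case `t ≥ 2`. Since `l ≤ 1 + e/2`, the left side is at most `2r - 1 +
r²td/2`; the right side exceeds this because `rt ≥ 2r`, `rt - 1 ≥ r` and `rtL > 0`. -/
theorem length_bound_lt {r t d e l L : ℕ} (hr : 0 < r) (ht : 2 ≤ t) (hed : e ≤ t * d)
    (hl : 2 * l ≤ 2 + e) (hL : 0 < L) :
    r - 1 + r.choose 2 * e + r * l < r * t - 1 + (r * t).choose 2 * d + r * t * L := by
  obtain ⟨r, rfl⟩ := Nat.exists_eq_succ_of_ne_zero hr.ne'
  obtain ⟨t, rfl⟩ := Nat.exists_eq_add_of_le ht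
  have hrt : (r + 1) * (2 + t) = (2 * r + 1 + (r * t + t)) + 1 := by ring
  have h1 : (r + 1).choose 2 * 2 = (r + 1) * r := by
    rw [Nat.choose_two_right, Nat.div_mul_cancel (Nat.even_mul_pred_self _).two_dvd]
    simp
  have h2 : ((r + 1) * (2 + t)).choose 2 * 2 =
      ((r + 1) * (2 + t)) * (2 * r + 1 + (r * t + t)) := by
    rw [Nat.choose_two_right, Nat.div_mul_cancel (Nat.even_mul_pred_self _).two_dvd]
    congr 1
    omega
  have a1 : (r + 1) * r * e ≤ (r + 1) * r * ((2 + t) * d) := Nat.mul_le_mul_left _ hed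
  have a2 : (r + 1) * (2 * l) ≤ (r + 1) * (2 + (2 + t) * d) :=
    Nat.mul_le_mul_left _ (by omega)
  have a3 : (r + 1) * (2 + t) * 1 ≤ (r + 1) * (2 + t) * L := Nat.mul_le_mul_left _ hL
  have a4 : 0 ≤ (r + 1) * (2 + t) * (r + r * t + t) * d := Nat.zero_le _
  have e1 : 2 * ((r + 1).choose 2 * e) = (r + 1) * r * e := by rw [← h1]; ring
  have e2 : 2 * (((r + 1) * (2 + t)).choose 2 * d) =
      ((r + 1) * (2 + t)) * (2 * r + 1 + (r * t + t)) * d := by rw [← h2]; ring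
  have e3 : (r + 1) * (2 + t) - 1 = 2 * r + 1 + (r * t + t) := by omega
  rw [e3]
  simp only [Nat.succ_eq_add_one, Nat.add_sub_cancel]
  nlinarith

variable (k : Type*) [Field k]

/-- The induction is on `dim_k End_K(V)` with `K` varying, since the irreducible case passes to
`Eᵐᵒᵖ`. A common universe for `K` and `V` keeps that pair within reach of the hypothesis. -/
theorem len_end_le (K : Type u) [DivisionRing K] [Algebra k K] [FiniteDimensional k K]
    (V : Type u) [AddCommGroup V] [Module K V] [Module k V] [IsScalarTower k K V]
    [Module.Finite K V] (hV : 0 < Module.finrank K V) :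
    len k (Module.End K V) ≤ Module.finrank K V - 1 +
      (Module.finrank K V).choose 2 * Module.finrank k K +
      Module.finrank K V * len k (Module.End K K) := by
  induction hN : Module.finrank k (Module.End K V) using Nat.strong_induction_on
    generalizing K V with
  | _ N ih =>
  have := finiteDimensional_hom k (K := K) (V := V) (U := V)
  have := finiteDimensional_hom k (K := K) (V := K) (U := K)
  rw [finrank_hom] at hN
  have hd : 0 < Module.finrank k K := Module.finrank_pos
  have hL : 0 < len k (Module.End K K) := len_pos
  rcases (show Module.finrank K V = 1 ∨ 2 ≤ Module.finrank K V by omega) with h1 | h2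
  · simp [len_end_congr k (V := V) (U := K) (by rw [h1, Module.finrank_self]), h1]
  refine len_le_of_forall_lt fun B hB => ?_
  by_cases hred : ∀ W : Submodule K V, (∀ f ∈ B, ∀ w ∈ W, f w ∈ W) → W = ⊥ ∨ W = ⊤
  · have : Nontrivial V := Module.nontrivial_of_finrank_pos (R := K) hV
    have hB0 : B ≠ ⊥ := by
      rintro rfl
      obtain ⟨v, hv⟩ := exists_ne (0 : V)
      have hW := finrank_span_singleton (K := K) hv
      rcases hred (Submodule.span K {v}) fun f hf w _ => by
        rw [NonUnitalAlgebra.mem_bot.mp hf]; exact zero_mem _ with h | h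
      · rw [h, finrank_bot] at hW; omega
      · rw [h, finrank_top] at hW; omega
    let R : Subalgebra k (Module.End K V) := Algebra.adjoin k B
    have : FiniteDimensional k R := inferInstanceAs (FiniteDimensional k (Subalgebra.toSubmodule R))
    have : FiniteDimensional k B := inferInstanceAs (FiniteDimensional k B.toSubmodule)
    have hsimple : IsSimpleRing R := isSimpleRing_of_irreducible fun W hW =>
      hred W fun f hf => hW f (Algebra.subset_adjoin hf)
    have hBR : ∀ x ∈ R, x ∈ B := fun x hx => mem_of_mem_adjoin hB0 hx
    let j : B →ₙₐ[k] R :=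
      { toFun := fun b => ⟨b, Algebra.subset_adjoin b.2⟩
        map_smul' := fun _ _ => rfl
        map_zero' := rfl
        map_add' := fun _ _ => rfl
        map_mul' := fun _ _ => rfl }
    have hj : Function.Bijective j :=
      ⟨fun a b h => Subtype.ext (congrArg (fun x : R => (x : Module.End K V)) h),
        fun x => ⟨⟨x, hBR x x.2⟩, rfl⟩⟩
    have : IsArtinianRing R := IsArtinianRing.of_finite k R
    obtain ⟨r, _, E, _, _, _, ⟨ψ⟩⟩ :=
      IsSimpleRing.exists_algEquiv_matrix_divisionRing_finite k R
    let φ : Matrix (Fin r) (Fin r) E →ₐ[k] Module.End K V := R.val.comp ψ.symm.toAlgHom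
    have hr : 0 < r := Nat.pos_of_neZero r
    have hn := finrank_eq_mul_finrank_cornerSpace φ
    set t := Module.finrank K (cornerSpace φ) with ht
    have ht0 : 0 < t := Nat.pos_of_ne_zero fun h => by rw [h] at hn; omega
    have : Nontrivial (cornerSpace φ) := Module.nontrivial_of_finrank_pos (R := K) ht0
    have hed := finrank_le_finrank_cornerSpace_mul φ
    have hdim : r * r * Module.finrank k E < N := by
      have e1 : Module.finrank k R = r * r * Module.finrank k E := by
        rw [ψ.toLinearEquiv.finrank_eq, Module.finrank_matrix]
        simp
      have e2 : Module.finrank k R < Module.finrank k (Module.End K V) :=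
        Submodule.finrank_lt (s := Subalgebra.toSubmodule R) fun h =>
          hB (NonUnitalAlgebra.eq_top_iff.mpr fun x => hBR x (by
            rw [← Subalgebra.mem_toSubmodule, h]; trivial))
      rw [finrank_hom, hN, e1] at e2
      exact e2
    have : FiniteDimensional k Eᵐᵒᵖ := Module.Finite.equiv (MulOpposite.opLinearEquiv k)
    have hlen : len k B ≤ r - 1 + r.choose 2 * Module.finrank k E + r * len k E := by
      rw [len_eq_of_bijective hj, len_eq_of_algEquiv ψ, len_eq_of_algEquiv (matrixAlgEquivEnd k E r)]
      have := ih _ hdim Eᵐᵒᵖ (Fin r → E) (by rwa [finrank_mulOpposite_pi])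
        (by rw [finrank_hom, finrank_mulOpposite_pi, finrank_mulOpposite])
      rwa [finrank_mulOpposite_pi, finrank_mulOpposite, len_end_mulOpposite] at this
    refine hlen.trans_lt ?_
    rcases (show t = 1 ∨ 2 ≤ t by omega) with ht1 | ht2
    · rw [ht1, mul_one] at hn
      rw [hn] at hN ⊢
      -- Now `n = r`, so `r²[E : k] < r²[K : k]`.
      have hlt : Module.finrank k E < Module.finrank k K :=
        lt_of_mul_lt_mul_left (hN ▸ hdim) (Nat.zero_le _)
      have hl := len_lt_len_end_of_finrank_cornerSpace_eq_one φ ht1 hlt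
      have b1 : r.choose 2 * Module.finrank k E ≤ r.choose 2 * Module.finrank k K :=
        Nat.mul_le_mul_left _ hlt.le
      have b2 : r * len k E < r * len k (Module.End K K) := Nat.mul_lt_mul_of_pos_left hl hr
      omega
    · rw [hn]
      exact length_bound_lt hr ht2 hed two_mul_len_le hL
  · push Not at hred
    obtain ⟨W, hW, hW0, hW1⟩ := hred
    have hle : B ≤ stabilizer k W := hW
    have : FiniteDimensional k (stabilizer k W) :=
      inferInstanceAs (FiniteDimensional k (stabilizer k W).toSubmodule)
    have : FiniteDimensional k B := inferInstanceAs (FiniteDimensional k B.toSubmodule)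
    have hlen := len_le_of_injective (NonUnitalSubalgebra.inclusion_injective hle)
    rw [len_stabilizer] at hlen
    have hsum := W.finrank_quotient_add_finrank
    have ha : 0 < Module.finrank K W :=
      Nat.pos_of_ne_zero fun h => hW0 (Submodule.finrank_eq_zero.mp h)
    have hb : 0 < Module.finrank K (V ⧸ W) := by
      have := Submodule.finrank_lt hW1
      omega
    have hlt : ∀ c, c < Module.finrank K V → c * c * Module.finrank k K < N := fun c hc => by
      rw [← hN]
      exact Nat.mul_lt_mul_of_pos_right (Nat.mul_self_lt_mul_self hc) hd
    have h3 := ih _ (hlt _ (by omega)) K W ha (finrank_hom k)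
    have h4 := ih _ (hlt _ (by omega)) K (V ⧸ W) hb (finrank_hom k)
    generalize Module.finrank K W = a at *
    generalize Module.finrank K (V ⧸ W) = b at *
    rw [← hsum]
    -- The cross term `ab` matches the stabilizer's radical, while `(a - 1) + (b - 1)` falls one
    -- short of `a + b - 1`, giving strictness.
    have hc : (b + a).choose 2 = b.choose 2 + a.choose 2 + a * b := by
      rw [Nat.add_choose_eq]
      simp [Finset.Nat.antidiagonal_succ]
      ring
    rw [hc]
    obtain ⟨a, rfl⟩ := Nat.exists_eq_succ_of_ne_zero ha.ne'
    obtain ⟨b, rfl⟩ := Nat.exists_eq_succ_of_ne_zero hb.ne'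
    have e3 : (b + 1) + (a + 1) - 1 = a + b + 1 := by omega
    simp only [Nat.succ_eq_add_one, Nat.add_sub_cancel, e3] at *
    linarith

/-- The length of a matrix algebra over a division algebra. -/
theorem len_matrix (D : Type u) [DivisionRing D] [Algebra k D] [FiniteDimensional k D] {n : ℕ}
    (hn : 1 ≤ n) : len k (Matrix (Fin n) (Fin n) D) =
      n - 1 + n * (n - 1) * Module.finrank k D / 2 + n * len k D := by
  have : FiniteDimensional k Dᵐᵒᵖ := Module.Finite.equiv (MulOpposite.opLinearEquiv k)
  obtain ⟨m, rfl⟩ := Nat.exists_eq_succ_of_ne_zero (Nat.one_le_iff_ne_zero.mp hn)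
  have hle := len_end_le k Dᵐᵒᵖ (Fin (m + 1) → D) (by rw [finrank_mulOpposite_pi]; omega)
  have hge := le_len_end k (K := Dᵐᵒᵖ) (V := Fin (m + 1) → D) (finrank_mulOpposite_pi D _)
  rw [finrank_mulOpposite_pi] at hle
  rw [finrank_mulOpposite, len_end_mulOpposite, ← len_eq_of_algEquiv (matrixAlgEquivEnd k D (m + 1))]
    at hle hge
  -- The natural-number division is exact because `(m + 1)m` is even.
  have : (m + 1) * (m + 1 - 1) * Module.finrank k D / 2 =
      (m + 1).choose 2 * Module.finrank k D := by
    rw [Nat.choose_two_right, Nat.div_mul_right_comm (Nat.even_mul_pred_self _).two_dvd]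
  rw [Nat.succ_eq_add_one, this]
  exact le_antisymm hle hge

end UpperBound

/-! ### Contribution of the Jacobson radical -/

section Radical

variable (k : Type*) [Field k] (A : Type*) [NonUnitalRing A] [Module k A] [IsScalarTower k A A]
  [SMulCommClass k A A]

/-- The Jacobson radical as a subalgebra. -/
def radicalSubalgebra : NonUnitalSubalgebra k A :=
  (jacobsonRadical k A).toNonUnitalSubalgebra fun x _ _ hy => mul_mem_jacobsonRadical_left k x hy

theorem len_radicalSubalgebra [FiniteDimensional k A] :
    len k (radicalSubalgebra k A) = Module.finrank k (jacobsonRadical k A) := by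
  have : FiniteDimensional k (radicalSubalgebra k A) :=
    inferInstanceAs (FiniteDimensional k (jacobsonRadical k A))
  have : FiniteDimensional k (Unitization k A) :=
    Module.Finite.equiv (Unitization.linearEquiv k (R := k) (A := A)).symm
  have : IsArtinianRing (Unitization k A) := IsArtinianRing.of_finite k _
  obtain ⟨m, hm⟩ := IsSemiprimaryRing.isNilpotent (R := Unitization k A)
  let ι : radicalSubalgebra k A →ₗ[k] Unitization k A :=
    ((Unitization.inrNonUnitalAlgHom k A).comp
      (NonUnitalSubalgebraClass.subtype (radicalSubalgebra k A)) : _ →ₙₐ[k] _)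
  have hι : Function.Injective ι := Unitization.inr_injective.comp Subtype.val_injective
  -- The filtration is pulled back from powers of the nilpotent radical of the unitization, which
  -- contains the image of `J(A)`.
  refine len_eq_finrank_of_filtration
    (fun i => ((Ring.jacobson (Unitization k A) ^ i).restrictScalars k).comap ι) m ?_ ?_ ?_
  · rw [Submodule.pow_zero, Ideal.one_eq_top, Submodule.restrictScalars_top, Submodule.comap_top]
  · rw [hm]
    exact LinearMap.ker_eq_bot.mpr hι
  · intro i x hx y
    have hxy : ι (x * y) = ι x * ι y := Unitization.inr_mul ..
    rw [Submodule.mem_comap, Submodule.restrictScalars_mem] at hx ⊢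
    rw [hxy, Submodule.pow_succ]
    exact Ideal.mul_mem_mul hx ((forall_isQuasiregular_iff k (y : A)).mp y.2)

/-- The projection onto the quotient by the Jacobson radical, as an algebra homomorphism. -/
def RadicalQuotient.projHom : A →ₙₐ[k] RadicalQuotient k A where
  toFun := RadicalQuotient.proj k
  map_smul' := map_smul (RadicalQuotient.proj k)
  map_zero' := map_zero (RadicalQuotient.proj k)
  map_add' := map_add (RadicalQuotient.proj k)
  map_mul' := RadicalQuotient.proj_mul k

theorem len_eq_finrank_jacobsonRadical_add [FiniteDimensional k A] {C : Type*} [NonUnitalRing C]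
    [Module k C] [IsScalarTower k C C] [SMulCommClass k C C]
    (e : RadicalQuotient k A →ₙₐ[k] C) (he : Function.Bijective e) :
    len k A = Module.finrank k (jacobsonRadical k A) + len k C := by
  have : FiniteDimensional k (radicalSubalgebra k A) :=
    inferInstanceAs (FiniteDimensional k (jacobsonRadical k A))
  rw [← len_radicalSubalgebra]
  refine len_eq_add (f := NonUnitalSubalgebraClass.subtype (radicalSubalgebra k A))
    (g := e.comp (RadicalQuotient.projHom k A)) Subtype.val_injective
    (he.2.comp (RadicalQuotient.proj_surjective k)) fun a => ?_
  rw [NonUnitalAlgHom.comp_apply, map_eq_zero_iff e he.1]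
  refine (RadicalQuotient.proj_eq_zero_iff k a).trans ⟨fun h => ⟨⟨a, h⟩, rfl⟩, ?_⟩
  rintro ⟨b, rfl⟩
  exact b.2

end Radical

end AssocAlg

/-! ### Assembly of the length formula -/

theorem mainTheorem1 {k : Type*} [Field k]
    {A : Type*} [NonUnitalRing A] [Module k A] [IsScalarTower k A A] [SMulCommClass k A A]
    [FiniteDimensional k A]
    {ι : Type*} [Fintype ι] (n : ι → ℕ) (hn : ∀ i, 1 ≤ n i)
    (D : ι → Type*) [∀ i, DivisionRing (D i)] [∀ i, Algebra k (D i)]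
    (e : AssocAlg.RadicalQuotient k A →ₙₐ[k] (∀ i, Matrix (Fin (n i)) (Fin (n i)) (D i)))
    (he : Function.Bijective e) :
    AssocAlg.length k A =
      (Module.finrank k (AssocAlg.jacobsonRadical k A) : ℕ∞) +
        ∑ i, (((n i - 1 + n i * (n i - 1) * Module.finrank k (D i) / 2 : ℕ) : ℕ∞) +
          (n i : ℕ∞) * AssocAlg.length k (D i)) := by
  -- Finite dimensionality of each `D i` is inherited from `A` through the quotient, a matrix factor
  -- and a matrix entry.
  have hpi : FiniteDimensional k (∀ i, Matrix (Fin (n i)) (Fin (n i)) (D i)) :=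
    Module.Finite.of_surjective
      ((e.comp (AssocAlg.RadicalQuotient.projHom k A) : _ →ₙₐ[k] _) : A →ₗ[k] _)
      (he.2.comp (AssocAlg.RadicalQuotient.proj_surjective k))
  have hM : ∀ i, FiniteDimensional k (Matrix (Fin (n i)) (Fin (n i)) (D i)) := fun i =>
    Module.Finite.of_surjective (LinearMap.proj (R := k)
      (φ := fun i => Matrix (Fin (n i)) (Fin (n i)) (D i)) i) (Function.surjective_eval i)
  have hD : ∀ i, FiniteDimensional k (D i) := fun i =>
    Module.Finite.of_surjective (Matrix.entryLinearMap k (D i) (⟨0, hn i⟩ : Fin (n i)) (⟨0, hn i⟩ : Fin (n i)))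
      fun x => ⟨fun _ _ => x, rfl⟩
  rw [AssocAlg.length_eq_len, AssocAlg.len_eq_finrank_jacobsonRadical_add k A e he,
    AssocAlg.len_pi]
  push_cast
  congr 1
  refine Finset.sum_congr rfl fun i _ => ?_
  rw [AssocAlg.length_eq_len, AssocAlg.len_matrix k (D i) (hn i)]
  push_cast
  rfl
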